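/- Throughout, $\mathbb{R}^n$ carries the usual inner product, and a convex cone is a nonempty set $K\subseteq\mathbb{R}^n$ with $tx+sy\in K$ for all $x,y\in K$ and $t,s\ge 0$. A convex cone $K$ is *proper* if it is closed, $K\cap(-K)=\{0\}$, and $K$ has nonempty interior; it is *polyhedral* if it is closed and is the conic hull (the set of all finite nonnegative linear combinations) of a finite set; it is *permutation invariant* if $\sigma(K)=K$ for every $n\times n$ permutation matrix $\sigma$. A nonzero vector $x\in K$ is an *extreme vector* of $K$ if $x=y+z$ with $y,z\in K$ implies that $y$ and $z$ are both nonnegative scalar multiples of $x$; extreme vectors that are positive scalar multiples of each other are regarded as the same. A convex cone $K$ is *reducible* if $K=K_1+K_2$ for some nonempty sets $K_1,K_2\subseteq\mathbb{R}^n$, both different from $\{0\}$, with $\operatorname{span}(K_1)\cap\operatorname{span}(K_2)=\{0\}$; a nonzero convex cone is *irreducible* if it is not reducible. With $K^*=\{s:\langle s,x\rangle\ge 0\ \text{for all } x\in K\}$, the *Lyapunov rank* $\beta(K)$ is the dimension of the real vector space of all linear maps $L:\mathbb{R}^n\to\mathbb{R}^n$ such that $\langle L(x),s\rangle=0$ whenever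 $x\in K$, $s\in K^*$ and $\langle x,s\rangle=0$. Let $Q$ be a permutation invariant proper polyhedral cone in $\mathbb{R}^n$. If $Q$ has more than $n$ extreme vectors (counted up to positive scalar multiples), then $Q$ is irreducible and $\beta(Q)=1$. -/

import Mathlib

open scoped Pointwise RealInnerProductSpace

namespace LyapunovRank

/-! A convex cone (closed under nonnegative combinations, hence containing `0`) is a
`PointedCone ℝ V` in the terminology of Mathlib. -/

section General

variable {V : Type*} [NormedAddCommGroup V] [InnerProductSpace ℝ V]

/-- A proper cone: a closed convex cone that is pointed (`K ∩ -K = {0}`) and solid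
(nonempty interior). -/
structure IsProperCone (K : PointedCone ℝ V) : Prop where
  isClosed : IsClosed (K : Set V)
  pointed : (K : Set V) ∩ -(K : Set V) = {0}
  solid : (interior (K : Set V)).Nonempty

/-- A polyhedral cone: a closed convex cone that is the conic hull of a finite set. -/
structure IsPolyhedralCone (K : PointedCone ℝ V) : Prop where
  isClosed : IsClosed (K : Set V)
  finitelyGenerated : ∃ S : Set V, S.Finite ∧ K = PointedCone.hull ℝ S

/-- Extreme vectors of a convex cone. -/
def IsExtremeVector (K : PointedCone ℝ V) (x : V) : Prop :=
  x ∈ K ∧ x ≠ 0 ∧ ∀ y ∈ K, ∀ z ∈ K, x = y + z →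
    (∃ a : ℝ, 0 ≤ a ∧ y = a • x) ∧ (∃ b : ℝ, 0 ≤ b ∧ z = b • x)

/-- Two extreme vectors are equivalent if they are positive scalar multiples of each other. -/
def extremeVectorSetoid (K : PointedCone ℝ V) : Setoid {x : V // IsExtremeVector K x} where
  r x y := ∃ t : ℝ, 0 < t ∧ (y : V) = t • (x : V)
  iseqv :=
    { refl := fun x => ⟨1, one_pos, (one_smul ℝ (x : V)).symm⟩
      symm := by
        rintro x y ⟨t, ht, h⟩
        exact ⟨t⁻¹, inv_pos.mpr ht, by rw [h, smul_smul, inv_mul_cancel₀ ht.ne', one_smul]⟩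
      trans := by
        rintro x y z ⟨t, ht, h⟩ ⟨s, hs, h2⟩
        exact ⟨s * t, mul_pos hs ht, by rw [h2, h, smul_smul]⟩ }

/-- The number (possibly infinite) of extreme vectors of `K`, equivalent ones being identified. -/
noncomputable def numExtremeVectors (K : PointedCone ℝ V) : ℕ∞ :=
  ENat.card (Quotient (extremeVectorSetoid K))

/-- `K` is reducible: `K = K₁ + K₂` for nonempty sets `K₁, K₂ ≠ {0}` whose spans meet only
in `0`. -/
def IsReducible (K : PointedCone ℝ V) : Prop :=
  ∃ K₁ K₂ : Set V, K₁.Nonempty ∧ K₁ ≠ {0} ∧ K₂.Nonempty ∧ K₂ ≠ {0} ∧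
    (K : Set V) = K₁ + K₂ ∧ Submodule.span ℝ K₁ ⊓ Submodule.span ℝ K₂ = ⊥

/-- A nonzero convex cone is irreducible if it is not reducible. -/
def IsIrreducible (K : PointedCone ℝ V) : Prop :=
  K ≠ ⊥ ∧ ¬ IsReducible K

/-- The space `LL(K)` of Lyapunov-like transformations on `K`: the linear maps `L` with
`⟪L x, s⟫ = 0` whenever `x ∈ K`, `s` lies in the dual cone of `K`, and `⟪x, s⟫ = 0`. -/
def lyapunovLike [CompleteSpace V] (K : PointedCone ℝ V) : Submodule ℝ (V →ₗ[ℝ] V) where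
  carrier := {L | ∀ x ∈ K, ∀ s ∈ ProperCone.innerDual (K : Set V), ⟪x, s⟫ = 0 → ⟪L x, s⟫ = 0}
  zero_mem' := by
    intro x _ s _ _
    simp
  add_mem' := by
    intro L M hL hM x hx s hs h
    rw [LinearMap.add_apply, inner_add_left, hL x hx s hs h, hM x hx s hs h, add_zero]
  smul_mem' := by
    intro c L hL x hx s hs h
    rw [LinearMap.smul_apply, real_inner_smul_left, hL x hx s hs h, mul_zero]

/-- The Lyapunov rank `β(K) = dim LL(K)`. -/
noncomputable def lyapunovRank [CompleteSpace V] (K : PointedCone ℝ V) : ℕ :=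
  Module.finrank ℝ (lyapunovLike K)

end General

/-- `Q` is permutation invariant: `σ(Q) = Q` for every permutation `σ` of the coordinates. -/
def IsPermutationInvariant {n : ℕ} (Q : PointedCone ℝ (EuclideanSpace ℝ (Fin n))) : Prop :=
  ∀ σ : Equiv.Perm (Fin n),
    (LinearIsometryEquiv.piLpCongrLeft 2 ℝ ℝ σ) '' (Q : Set (EuclideanSpace ℝ (Fin n))) =
      (Q : Set (EuclideanSpace ℝ (Fin n)))

end LyapunovRank

namespace LyapunovRank

section Cones

variable {V : Type*} [NormedAddCommGroup V] [InnerProductSpace ℝ V]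

/-! A Lyapunov-like map of a proper polyhedral cone has every extreme vector as an eigenvector, so
it suffices to show that maps with this property are scalars; `not_isReducible_of_forall_scalar`
then also excludes a splitting, since its projection would be such a map.

Extreme vectors separated by the eigenvalues of such maps are independent, so more than `n` of them
leave two non-parallel `x`, `y` that always share an eigenvalue. One of them, say `x`, has `x i ≠ x
j`. Let `τ` swap `i` and `j`. A `τ`-fixed combination `y - t • x ≠ 0` forces the eigenvalues at `x`
and `τ x` to agree, so `x - τ x`, a multiple of `e_i - e_j`, is an eigenvector. By symmetry so is
every `e_a - e_b`, whence `L = c + (∑ k, x k) • w`. If `w ≠ 0`, then `x` and `y` are both parallel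
to `w`, because neither the coordinate sum of `x` nor its eigenvalue shift vanishes: a
contradiction. -/

/-! ### Finitely generated cones are closed -/

lemma mem_hull_finset_iff {T : Finset V} {x : V} :
    x ∈ PointedCone.hull ℝ (T : Set V) ↔
      ∃ c : V → ℝ, (∀ s ∈ T, 0 ≤ c s) ∧ ∑ s ∈ T, c s • s = x := by
  constructor
  · intro h
    obtain ⟨f, -, hf⟩ := Submodule.mem_span_finset.1 h
    exact ⟨fun s => (f s : ℝ), fun s _ => (f s).2, hf⟩
  · rintro ⟨c, hc, rfl⟩
    exact Submodule.sum_mem _ fun s hs =>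
      PointedCone.smul_mem _ (hc s hs) (Submodule.subset_span hs)

/-- Conic Carathéodory step: a linearly dependent generating set can be shrunk at each point. -/
lemma exists_mem_hull_erase [DecidableEq V] {T : Finset V}
    (hT : ¬ LinearIndepOn ℝ id (T : Set V)) {x : V}
    (hx : x ∈ PointedCone.hull ℝ (T : Set V)) :
    ∃ s ∈ T, x ∈ PointedCone.hull ℝ ((T.erase s : Finset V) : Set V) := by
  obtain ⟨c, hc, hcx⟩ := mem_hull_finset_iff.1 hx
  obtain ⟨g, hg0, hgpos⟩ : ∃ g : V → ℝ, ∑ s ∈ T, g s • s = 0 ∧ ∃ s ∈ T, 0 < g s := by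
    rw [linearIndepOn_finset_iff] at hT
    push Not at hT
    obtain ⟨g, hg, s, hs, hgs⟩ := hT
    rcases lt_or_gt_of_ne hgs with h | h
    · refine ⟨fun s => -g s, ?_, s, hs, by simpa using h⟩
      simpa using hg
    · exact ⟨g, by simpa using hg, s, hs, h⟩
  obtain ⟨s₁, hs₁, hgs₁⟩ := hgpos
  -- Subtracting the smallest ratio times the relation `g` cancels the coefficient of `s` and keeps
  -- the others nonnegative.
  obtain ⟨s, hs, hmin⟩ := (T.filter fun s => 0 < g s).exists_min_image (fun s => c s / g s)
    ⟨s₁, Finset.mem_filter.2 ⟨hs₁, hgs₁⟩⟩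
  rw [Finset.mem_filter] at hs
  have hr : 0 ≤ c s / g s := div_nonneg (hc s hs.1) hs.2.le
  refine ⟨s, hs.1, mem_hull_finset_iff.2 ⟨fun a => c a - c s / g s * g a, ?_, ?_⟩⟩
  · intro a ha
    have haT := Finset.mem_of_mem_erase ha
    rcases le_or_gt (g a) 0 with h | h
    · have := hc a haT
      nlinarith
    · have := hmin a (Finset.mem_filter.2 ⟨haT, h⟩)
      rw [le_div_iff₀ h] at this
      linarith
  · have h0 : (c s - c s / g s * g s) • s = 0 := by
      rw [div_mul_cancel₀ _ hs.2.ne', sub_self, zero_smul]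
    rw [Finset.sum_erase T (f := fun a => (c a - c s / g s * g a) • a) h0]
    simp only [sub_smul, mul_smul, Finset.sum_sub_distrib, ← Finset.smul_sum, hg0, hcx]
    simp

/-- Independent generators embed an orthant as a closed set; dependent ones reduce to a finite union
of smaller hulls. -/
lemma isClosed_hull_finset (T : Finset V) :
    IsClosed (PointedCone.hull ℝ (T : Set V) : Set V) := by
  classical
  induction T using Finset.strongInduction with
  | H T ih =>
    by_cases hT : LinearIndepOn ℝ id (T : Set V)
    · let f : (T → ℝ) →ₗ[ℝ] V := Fintype.linearCombination ℝ (fun s : T => (s : V))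
      have hf : Function.Injective f :=
        linearIndependent_iff_injective_fintypeLinearCombination.1 hT
      have hcl := (LinearMap.isClosedEmbedding_of_injective
        (LinearMap.ker_eq_bot.2 hf)).isClosedMap {c : T → ℝ | ∀ s, 0 ≤ c s} (by
          simp only [Set.ofPred_forall]
          exact isClosed_iInter fun s => isClosed_le continuous_const (continuous_apply s))
      convert hcl
      ext x
      rw [SetLike.mem_coe, mem_hull_finset_iff]
      constructor
      · rintro ⟨c, hc, rfl⟩
        refine ⟨fun s => c s, fun s => hc s s.2, ?_⟩
        simp only [f, Fintype.linearCombination_apply]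
        exact Finset.sum_coe_sort T fun s => c s • s
      · rintro ⟨c, hc, rfl⟩
        refine ⟨fun s => if h : s ∈ T then c ⟨s, h⟩ else 0, fun s hs => ?_, ?_⟩
        · simpa [hs] using hc ⟨s, hs⟩
        · simp only [f, Fintype.linearCombination_apply]
          rw [← Finset.sum_coe_sort T]
          simp
    · have : (PointedCone.hull ℝ (T : Set V) : Set V) =
          ⋃ s ∈ T, (PointedCone.hull ℝ ((T.erase s : Finset V) : Set V) : Set V) := by
        ext x
        simp only [Set.mem_iUnion, exists_prop]
        constructor
        · exact fun hx => exists_mem_hull_erase hT hx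
        · rintro ⟨s, -, hx⟩
          exact Submodule.span_mono (Finset.coe_subset.2 (T.erase_subset s)) hx
      rw [this]
      exact T.finite_toSet.isClosed_biUnion fun s hs => ih _ (Finset.erase_ssubset hs)

/-! ### Proper cones and extreme vectors as eigenvectors -/

lemma IsProperCone.eq_zero {K : PointedCone ℝ V} (hK : IsProperCone K) {x : V}
    (hx : x ∈ K) (hx' : -x ∈ K) : x = 0 := by
  have : x ∈ (K : Set V) ∩ -(K : Set V) := ⟨hx, hx'⟩
  rwa [hK.pointed] at this

lemma IsProperCone.eq_zero_of_add_eq_zero {K : PointedCone ℝ V} (hK : IsProperCone K) {x y : V}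
    (hx : x ∈ K) (hy : y ∈ K) (h : x + y = 0) : x = 0 :=
  hK.eq_zero hx (by rwa [neg_eq_of_add_eq_zero_right h])

lemma IsProperCone.span_eq_top {K : PointedCone ℝ V} (hK : IsProperCone K) :
    Submodule.span ℝ (K : Set V) = ⊤ :=
  Submodule.eq_top_of_nonempty_interior' _ (hK.solid.mono (interior_mono Submodule.subset_span))

/-- A linear map is extreme-diagonal for `K` if every extreme vector of `K` is an eigenvector. -/
def IsExtremeDiagonal (K : PointedCone ℝ V) (L : V →ₗ[ℝ] V) : Prop :=
  ∀ x, IsExtremeVector K x → ∃ c : ℝ, L x = c • x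

/-- The functionals in the dual of `K` vanishing at `x` form the dual of `C = K + ℝ₊(-x)`, which is
closed as `K` is polyhedral. Separation puts `± L x` in `C`, and extremality of `x` reduces the
lineality space of `C` to the line of `x`. -/
lemma isExtremeDiagonal_of_mem_lyapunovLike [CompleteSpace V] {K : PointedCone ℝ V}
    (hK : IsProperCone K) (hp : IsPolyhedralCone K) {L : V →ₗ[ℝ] V} (hL : L ∈ lyapunovLike K) :
    IsExtremeDiagonal K L := by
  classical
  rintro x ⟨hxK, -, hx⟩
  obtain ⟨S, hS, hKS⟩ := hp.finitelyGenerated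
  obtain ⟨T, rfl⟩ := hS.exists_finset_coe
  let C : ProperCone ℝ V :=
    ⟨PointedCone.hull ℝ ((insert (-x) T : Finset V) : Set V), isClosed_hull_finset _⟩
  have hKC : ∀ y ∈ K, y ∈ C := by
    intro y hy
    rw [hKS] at hy
    exact Submodule.span_mono (Finset.coe_subset.2 (Finset.subset_insert _ _)) hy
  have hxC : -x ∈ C := Submodule.subset_span (Finset.mem_insert_self _ _)
  have horth : ∀ f : V, (∀ y ∈ C, 0 ≤ ⟪y, f⟫) → ⟪L x, f⟫ = 0 := by
    intro f hf
    refine hL x hxK f (fun y hy => hf y (hKC y hy)) ?_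
    have h1 := hf _ hxC
    have h2 := hf _ (hKC x hxK)
    rw [inner_neg_left] at h1
    linarith
  have hmem : L x ∈ C ∧ -L x ∈ C := by
    constructor
    · by_contra h
      obtain ⟨f, hf, hlt⟩ := ProperCone.hyperplane_separation' C h
      exact hlt.ne (horth f hf)
    · by_contra h
      obtain ⟨f, hf, hlt⟩ := ProperCone.hyperplane_separation' C h
      rw [inner_neg_left, horth f hf, neg_zero] at hlt
      exact lt_irrefl _ hlt
  have hdec : ∀ y ∈ C, ∃ a : ℝ, 0 ≤ a ∧ ∃ q ∈ K, y = a • (-x) + q := by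
    intro y hy
    change y ∈ PointedCone.hull ℝ ((insert (-x) T : Finset V) : Set V) at hy
    rw [Finset.coe_insert] at hy
    obtain ⟨a, q, hq, h⟩ := Submodule.mem_span_insert.1 hy
    exact ⟨a, a.2, q, by rw [hKS]; exact hq, h⟩
  obtain ⟨a, ha, q, hq, hLq⟩ := hdec _ hmem.1
  obtain ⟨b, hb, r, hr, hLr⟩ := hdec _ hmem.2
  have hsum : q + r = (a + b) • x := by
    have h : (a • (-x) + q) + (b • (-x) + r) = 0 := by
      rw [← hLq, ← hLr, add_neg_cancel]
    rw [← sub_eq_zero, ← h]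
    module
  suffices ∃ k : ℝ, q = k • x by
    obtain ⟨k, rfl⟩ := this
    exact ⟨k - a, by rw [hLq]; module⟩
  rcases (add_nonneg ha hb).eq_or_lt with h | h
  · rw [← h, zero_smul] at hsum
    exact ⟨0, by rw [hK.eq_zero_of_add_eq_zero hq hr hsum, zero_smul]⟩
  · obtain ⟨⟨k, -, hk⟩, -⟩ := hx _ (PointedCone.smul_mem _ (inv_pos.2 h).le hq) _
      (PointedCone.smul_mem _ (inv_pos.2 h).le hr)
      (by rw [← smul_add, hsum, smul_smul, inv_mul_cancel₀ h.ne', one_smul])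
    refine ⟨(a + b) * k, ?_⟩
    rw [mul_smul, ← hk, smul_smul, mul_inv_cancel₀ h.ne', one_smul]

/-! ### Co-eigen vectors -/

/-- Two vectors are co-eigen for `K` if every extreme-diagonal map having the first as an
eigenvector has the second as an eigenvector with the same eigenvalue. -/
def IsCoeigen (K : PointedCone ℝ V) (x y : V) : Prop :=
  ∀ L, IsExtremeDiagonal K L → ∀ c : ℝ, L x = c • x → L y = c • y

lemma IsCoeigen.symm {K : PointedCone ℝ V} {x y : V} (hx : IsExtremeVector K x)
    (hy : IsExtremeVector K y) (h : IsCoeigen K x y) : IsCoeigen K y x := by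
  intro L hL c hc
  obtain ⟨d, hd⟩ := hL x hx
  have := h L hL d hd
  rw [hc] at this
  rw [hd, smul_left_injective ℝ hy.2.1 this]

lemma IsExtremeVector.map {K : PointedCone ℝ V} {P : V ≃ₗ[ℝ] V}
    (hP : P '' (K : Set V) = K) {x : V} (hx : IsExtremeVector K x) :
    IsExtremeVector K (P x) := by
  have hmem : ∀ y, y ∈ K → P y ∈ K := fun y hy => by
    rw [← SetLike.mem_coe, ← hP]; exact ⟨y, hy, rfl⟩
  have hmem' : ∀ y, y ∈ K → ∃ z ∈ K, P z = y := fun y hy => by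
    rw [← SetLike.mem_coe, ← hP] at hy; exact hy
  refine ⟨hmem _ hx.1, by simpa using hx.2.1, ?_⟩
  intro y hy z hz h
  obtain ⟨y, hyK, rfl⟩ := hmem' y hy
  obtain ⟨z, hzK, rfl⟩ := hmem' z hz
  rw [← map_add] at h
  obtain ⟨⟨a, ha, h1⟩, ⟨b, hb, h2⟩⟩ := hx.2.2 y hyK z hzK (P.injective h)
  exact ⟨⟨a, ha, by rw [h1, map_smul]⟩, ⟨b, hb, by rw [h2, map_smul]⟩⟩

lemma IsExtremeDiagonal.conj {K : PointedCone ℝ V} {P : V ≃ₗ[ℝ] V}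
    (hP : P '' (K : Set V) = K) {L : V →ₗ[ℝ] V} (hL : IsExtremeDiagonal K L) :
    IsExtremeDiagonal K (P.symm.toLinearMap ∘ₗ L ∘ₗ P.toLinearMap) := by
  intro x hx
  obtain ⟨c, hc⟩ := hL _ (hx.map hP)
  exact ⟨c, by simp [hc]⟩

lemma IsCoeigen.map {K : PointedCone ℝ V} {P : V ≃ₗ[ℝ] V}
    (hP : P '' (K : Set V) = K) {x y : V} (h : IsCoeigen K x y) : IsCoeigen K (P x) (P y) := by
  intro L hL c hc
  have := h _ (hL.conj hP) c (by simp [hc])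
  simpa [LinearEquiv.symm_apply_eq] using this

/-- As for eigenvectors with distinct eigenvalues, except that the map `L` depends on the pair:
applying `L - c` to a relation kills the term at `a` but not the one at `i`. -/
lemma linearIndependent_of_not_isCoeigen {K : PointedCone ℝ V} {ι : Type*} {v : ι → V}
    (hv : ∀ i, IsExtremeVector K (v i)) (hne : ∀ i j, i ≠ j → ¬ IsCoeigen K (v i) (v j)) :
    LinearIndependent ℝ v := by
  classical
  rw [linearIndependent_iff']
  intro s
  induction s using Finset.induction_on with
  | empty => simp
  | insert a s ha ih =>
    intro g hg
    have hzero : ∀ i ∈ s, g i = 0 := by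
      intro i hi
      have hai : a ≠ i := fun h => ha (h ▸ hi)
      have hsep := hne a i hai
      simp only [IsCoeigen] at hsep
      push Not at hsep
      obtain ⟨L, hL, c, hca, hci⟩ := hsep
      choose d hd using fun j => hL (v j) (hv j)
      have hsum : ∑ j ∈ s, (g j * (d j - c)) • v j = 0 := by
        have h1 : ∑ j ∈ insert a s, (g j * (d j - c)) • v j =
            L (∑ j ∈ insert a s, g j • v j) - c • ∑ j ∈ insert a s, g j • v j := by
          rw [map_sum, Finset.smul_sum, ← Finset.sum_sub_distrib]
          refine Finset.sum_congr rfl fun j _ => ?_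
          rw [map_smul, hd]
          module
        have hda : d a = c := smul_left_injective ℝ (hv a).2.1 ((hd a).symm.trans hca)
        rwa [hg, map_zero, smul_zero, sub_zero, Finset.sum_insert ha, hda, sub_self, mul_zero,
          zero_smul, zero_add] at h1
      rcases mul_eq_zero.1 (ih _ hsum i hi) with h | h
      · exact h
      · exact absurd (by rw [hd, sub_eq_zero.1 h]) hci
    intro i hi
    rcases Finset.mem_insert.1 hi with rfl | hi
    · rw [Finset.sum_insert ha, Finset.sum_eq_zero fun j hj => by rw [hzero j hj, zero_smul],
        add_zero] at hg
      exact (smul_eq_zero.1 hg).resolve_right (hv i).2.1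
    · exact hzero i hi

lemma exists_isCoeigen_of_finrank_lt [FiniteDimensional ℝ V] {K : PointedCone ℝ V}
    (hK : IsProperCone K) (h : (Module.finrank ℝ V : ℕ∞) < numExtremeVectors K) :
    ∃ x y, IsExtremeVector K x ∧ IsExtremeVector K y ∧ IsCoeigen K x y ∧
      ∀ t : ℝ, y ≠ t • x := by
  by_contra! hcon
  have hli : LinearIndependent ℝ
      (fun q : Quotient (extremeVectorSetoid K) => (q.out : V)) := by
    refine linearIndependent_of_not_isCoeigen (K := K) (fun q => q.out.2) fun p q hpq hco => hpq ?_
    obtain ⟨t, ht⟩ := hcon _ _ p.out.2 q.out.2 hco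
    have htpos : 0 < t := by
      by_contra! hle
      refine q.out.2.2.1 (hK.eq_zero q.out.2.1 ?_)
      rw [ht, ← neg_smul]
      exact PointedCone.smul_mem _ (by linarith) p.out.2.1
    rw [← Quotient.out_eq p, ← Quotient.out_eq q]
    exact Quotient.sound ⟨t, htpos, ht⟩
  have := hli.finite
  have := Fintype.ofFinite (Quotient (extremeVectorSetoid K))
  have hcard := hli.fintype_card_le_finrank
  rw [numExtremeVectors, ENat.card_eq_coe_fintype_card] at h
  exact absurd (Nat.cast_lt.1 h) (not_lt.2 hcard)

/-! ### Consequences of all such maps being scalars -/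

lemma not_isReducible_of_forall_scalar {K : PointedCone ℝ V} (hK : IsProperCone K)
    (h : ∀ L, IsExtremeDiagonal K L → ∃ c : ℝ, ∀ x, L x = c • x) : ¬ IsReducible K := by
  rintro ⟨K₁, K₂, hn₁, h₁, hn₂, h₂, hsum, hinf⟩
  have hdisj : Disjoint (Submodule.span ℝ K₁) (Submodule.span ℝ K₂) := disjoint_iff.2 hinf
  have h0 : (0 : V) ∈ K₁ ∧ (0 : V) ∈ K₂ := by
    have : (0 : V) ∈ K₁ + K₂ := hsum ▸ Submodule.zero_mem K
    obtain ⟨a, ha, b, hb, hab⟩ := this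
    have hab : a + b = 0 := hab
    have ha0 : a = 0 := Submodule.disjoint_def.1 hdisj a (Submodule.subset_span ha) (by
      rw [eq_neg_of_add_eq_zero_left hab]
      exact Submodule.neg_mem _ (Submodule.subset_span hb))
    have hb0 : b = 0 := by rwa [ha0, zero_add] at hab
    exact ⟨ha0 ▸ ha, hb0 ▸ hb⟩
  have hs₁ : ∀ a ∈ K₁, a ∈ K := fun a ha => by
    rw [← SetLike.mem_coe, hsum]; exact ⟨a, ha, 0, h0.2, add_zero a⟩
  have hs₂ : ∀ a ∈ K₂, a ∈ K := fun a ha => by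
    rw [← SetLike.mem_coe, hsum]; exact ⟨0, h0.1, a, ha, zero_add a⟩
  have hcompl : IsCompl (Submodule.span ℝ K₁) (Submodule.span ℝ K₂) := by
    refine ⟨hdisj, codisjoint_iff.2 (eq_top_iff.2 ?_)⟩
    rw [← hK.span_eq_top, Submodule.span_le, hsum]
    rintro _ ⟨a, ha, b, hb, rfl⟩
    exact Submodule.add_mem_sup (Submodule.subset_span ha) (Submodule.subset_span hb)
  let L : V →ₗ[ℝ] V := (Submodule.span ℝ K₁).subtype ∘ₗ
    Submodule.projectionOnto _ _ hcompl
  have hL₁ : ∀ a ∈ K₁, L a = a := fun a ha => by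
    have := Submodule.projectionOnto_apply_left hcompl ⟨a, Submodule.subset_span ha⟩
    simp only [L, LinearMap.comp_apply]
    exact congrArg Subtype.val this
  have hL₂ : ∀ b ∈ K₂, L b = 0 := fun b hb => by
    have := Submodule.projectionOnto_apply_right hcompl ⟨b, Submodule.subset_span hb⟩
    simp only [L, LinearMap.comp_apply]
    exact congrArg Subtype.val this
  -- If `x = a + b` is extreme, then `L x = a` is a multiple of `x`.
  obtain ⟨c, hc⟩ := h L (by
    rintro x ⟨hxK, -, hx⟩
    rw [← SetLike.mem_coe, hsum] at hxK
    obtain ⟨a, ha, b, hb, rfl⟩ := hxK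
    obtain ⟨⟨k, -, hk⟩, -⟩ := hx a (hs₁ a ha) b (hs₂ b hb) rfl
    refine ⟨k, ?_⟩
    simp only at hk ⊢
    rw [← hk, map_add, hL₁ a ha, hL₂ b hb, add_zero])
  have hne : ∀ {S : Set V}, S.Nonempty → S ≠ {0} → ∃ a ∈ S, a ≠ 0 := by
    intro S hS hS0
    by_contra! hcon
    exact hS0 (hS.subset_singleton_iff.1 hcon)
  obtain ⟨a, ha, ha0⟩ := hne hn₁ h₁
  obtain ⟨b, hb, hb0⟩ := hne hn₂ h₂
  have h1 := hc a
  have h2 := hc b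
  rw [hL₂ b hb] at h2
  rw [hL₁ a ha, (smul_eq_zero.1 h2.symm).resolve_right hb0, zero_smul] at h1
  exact ha0 h1

lemma lyapunovRank_eq_one_of_forall_scalar [CompleteSpace V] [Nontrivial V]
    {K : PointedCone ℝ V} (h : ∀ L ∈ lyapunovLike K, ∃ c : ℝ, ∀ x, L x = c • x) :
    lyapunovRank K = 1 := by
  have hid : (LinearMap.id : V →ₗ[ℝ] V) ∈ lyapunovLike K := fun x _ s _ hxs => hxs
  refine finrank_eq_one (⟨LinearMap.id, hid⟩ : lyapunovLike K) ?_ ?_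
  · intro h0
    obtain ⟨x, hx⟩ := exists_ne (0 : V)
    exact hx (LinearMap.congr_fun (congrArg Subtype.val h0) x)
  · rintro ⟨L, hL⟩
    obtain ⟨c, hc⟩ := h L hL
    exact ⟨c, Subtype.ext (LinearMap.ext fun x => (hc x).symm)⟩

end Cones

section Permutation

variable {n : ℕ}

/-! ### Permutation invariance -/

/-- The permutation of coordinates, as a linear equivalence. -/
noncomputable def permEquiv (σ : Equiv.Perm (Fin n)) :
    EuclideanSpace ℝ (Fin n) ≃ₗ[ℝ] EuclideanSpace ℝ (Fin n) :=
  (LinearIsometryEquiv.piLpCongrLeft 2 ℝ ℝ σ).toLinearEquiv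

lemma permEquiv_apply (σ : Equiv.Perm (Fin n)) (x : EuclideanSpace ℝ (Fin n)) (k : Fin n) :
    permEquiv σ x k = x (σ.symm k) := rfl

lemma permEquiv_single (σ : Equiv.Perm (Fin n)) (i : Fin n) (a : ℝ) :
    permEquiv σ (EuclideanSpace.single i a) = EuclideanSpace.single (σ i) a :=
  LinearIsometryEquiv.piLpCongrLeft_single σ i a

lemma IsPermutationInvariant.image_permEquiv {Q : PointedCone ℝ (EuclideanSpace ℝ (Fin n))}
    (hQ : IsPermutationInvariant Q) (σ : Equiv.Perm (Fin n)) :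
    permEquiv σ '' (Q : Set (EuclideanSpace ℝ (Fin n))) = Q := hQ σ

lemma sub_permEquiv_swap (x : EuclideanSpace ℝ (Fin n)) (i j : Fin n) :
    x - permEquiv (Equiv.swap i j) x =
      (x i - x j) • (EuclideanSpace.single i (1 : ℝ) - EuclideanSpace.single j 1) := by
  ext k
  simp only [PiLp.sub_apply, PiLp.smul_apply, permEquiv_apply, Equiv.symm_swap,
    PiLp.single_apply, smul_eq_mul]
  by_cases hij : i = j
  · subst hij
    simp
  by_cases hki : k = i
  · subst hki
    simp [hij]
  by_cases hkj : k = j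
  · subst hkj
    simp [hki]
  · simp [hki, hkj, Equiv.swap_apply_of_ne_of_ne]

/-- In a permutation invariant pointed cone only the zero vector has coordinate sum zero. -/
lemma eq_zero_of_sum_eq_zero {Q : PointedCone ℝ (EuclideanSpace ℝ (Fin n))}
    (hQ : IsPermutationInvariant Q) (hK : IsProperCone Q) {x : EuclideanSpace ℝ (Fin n)}
    (hx : x ∈ Q) (h0 : ∑ k, x k = 0) : x = 0 := by
  have hmem : ∀ σ : Equiv.Perm (Fin n), permEquiv σ x ∈ Q := fun σ => by
    rw [← SetLike.mem_coe, ← hQ.image_permEquiv σ]; exact ⟨x, hx, rfl⟩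
  -- The orbit sum has equal coordinates with total zero; pointedness then kills its identity term.
  have hz : ∑ σ : Equiv.Perm (Fin n), permEquiv σ x = 0 := by
    set z := ∑ σ : Equiv.Perm (Fin n), permEquiv σ x with hzdef
    have hzk : ∀ k, z k = ∑ σ : Equiv.Perm (Fin n), x (σ k) := fun k => by
      rw [hzdef, WithLp.ofLp_sum, Finset.sum_apply]
      simp only [permEquiv_apply]
      exact Fintype.sum_equiv (Equiv.inv _) _ _ fun σ => rfl
    have hconst : ∀ k l, z k = z l := fun k l => by
      rw [hzk, hzk]
      refine Fintype.sum_equiv (Equiv.mulRight (Equiv.swap k l)) _ _ fun σ => ?_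
      simp
    have hsum : ∑ k, z k = 0 := by
      simp only [hzk]
      rw [Finset.sum_comm]
      refine Finset.sum_eq_zero fun σ _ => ?_
      rw [Equiv.sum_comp σ (fun k => x k), h0]
    ext k
    have hn : (n : ℝ) ≠ 0 := Nat.cast_ne_zero.2 (fun h => by subst h; exact k.elim0)
    rw [Finset.sum_congr rfl fun l _ => hconst l k] at hsum
    simpa [hn] using hsum
  rw [← Finset.add_sum_erase _ _ (Finset.mem_univ 1)] at hz
  exact hK.eq_zero_of_add_eq_zero hx (Submodule.sum_mem _ fun σ _ => hmem σ) hz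

/-- If `x` is co-eigen to a transposition moving it, then all differences of basis vectors are
eigenvectors of every extreme-diagonal map. -/
lemma exists_eigen_single_sub_single {Q : PointedCone ℝ (EuclideanSpace ℝ (Fin n))}
    (hQ : IsPermutationInvariant Q) {x : EuclideanSpace ℝ (Fin n)} (hx : IsExtremeVector Q x)
    {i j : Fin n} (hij : x i ≠ x j) (hco : IsCoeigen Q x (permEquiv (Equiv.swap i j) x))
    {a b : Fin n} (hab : a ≠ b) {L : EuclideanSpace ℝ (Fin n) →ₗ[ℝ] EuclideanSpace ℝ (Fin n)}
    (hL : IsExtremeDiagonal Q L) :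
    ∃ c : ℝ, L (EuclideanSpace.single a 1 - EuclideanSpace.single b 1) =
      c • (EuclideanSpace.single a (1 : ℝ) - EuclideanSpace.single b 1) := by
  have hne : i ≠ j := fun h => hij (by rw [h])
  obtain ⟨σ, hσi, hσj⟩ : ∃ σ : Equiv.Perm (Fin n), σ i = a ∧ σ j = b := by
    have hane : a ≠ Equiv.swap i a j := by
      intro h
      have := congrArg (Equiv.swap i a) h
      rw [Equiv.swap_apply_right, Equiv.swap_apply_self] at this
      exact hne this
    refine ⟨Equiv.swap (Equiv.swap i a j) b * Equiv.swap i a, ?_, ?_⟩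
    · rw [Equiv.Perm.mul_apply, Equiv.swap_apply_left, Equiv.swap_apply_of_ne_of_ne hane hab]
    · rw [Equiv.Perm.mul_apply, Equiv.swap_apply_left]
  have hL' := hL.conj (hQ.image_permEquiv σ)
  obtain ⟨c, hc⟩ := hL' x hx
  have hc' := hco _ hL' c hc
  have h := congrArg₂ (· - ·) hc hc'
  simp only [← map_sub, ← smul_sub, sub_permEquiv_swap] at h
  rw [map_smul, smul_comm] at h
  have h := smul_right_injective _ (sub_ne_zero.2 hij) h
  refine ⟨c, ?_⟩
  have := congrArg (permEquiv σ) h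
  simpa [permEquiv_single, hσi, hσj] using this

/-- A linear map acting diagonally on all differences of basis vectors is a scalar up to a map
factoring through the coordinate sum. -/
lemma exists_forall_sub_smul_eq {L : EuclideanSpace ℝ (Fin n) →ₗ[ℝ] EuclideanSpace ℝ (Fin n)}
    {i j : Fin n} (hij : i ≠ j)
    (hL : ∀ a b : Fin n, a ≠ b →
      ∃ c : ℝ, L (EuclideanSpace.single a 1 - EuclideanSpace.single b 1) =
        c • (EuclideanSpace.single a (1 : ℝ) - EuclideanSpace.single b 1)) :
    ∃ (c : ℝ) (w : EuclideanSpace ℝ (Fin n)), ∀ x, L x - c • x = (∑ k, x k) • w := by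
  obtain ⟨c, hc⟩ := hL i j hij
  have key : ∀ b, L (EuclideanSpace.single i 1 - EuclideanSpace.single b 1) =
      c • (EuclideanSpace.single i (1 : ℝ) - EuclideanSpace.single b 1) := by
    intro b
    by_cases hib : i = b
    · subst hib
      simp
    by_cases hbj : b = j
    · rw [hbj, hc]
    obtain ⟨d, hd⟩ := hL i b hib
    obtain ⟨e, he⟩ := hL b j hbj
    have hsum : c • (EuclideanSpace.single i (1 : ℝ) - EuclideanSpace.single j 1) =
        d • (EuclideanSpace.single i (1 : ℝ) - EuclideanSpace.single b 1) +
          e • (EuclideanSpace.single b (1 : ℝ) - EuclideanSpace.single j 1) := by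
      rw [← hc, ← hd, ← he, ← map_add, sub_add_sub_cancel]
    have hcd : c = d := by
      have := congrArg (fun v : EuclideanSpace ℝ (Fin n) => v i) hsum
      simpa [PiLp.single_apply, hij, hib] using this
    rw [hd, hcd]
  refine ⟨c, L (EuclideanSpace.single i 1) - c • EuclideanSpace.single i 1, fun x => ?_⟩
  have hb : ∀ b, L (EuclideanSpace.single b 1) - c • EuclideanSpace.single b (1 : ℝ) =
      L (EuclideanSpace.single i 1) - c • EuclideanSpace.single i 1 := fun b => by
    have := key b
    rw [map_sub, smul_sub, sub_eq_sub_iff_sub_eq_sub] at this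
    exact this.symm
  have hx : x = ∑ k, x k • EuclideanSpace.single k (1 : ℝ) := by
    ext l
    simp [WithLp.ofLp_sum, Finset.sum_apply, Pi.single_apply]
  conv_lhs => rw [hx]
  rw [map_sum, Finset.smul_sum, ← Finset.sum_sub_distrib, Finset.sum_smul]
  refine Finset.sum_congr rfl fun k _ => ?_
  rw [map_smul, smul_comm, ← smul_sub, hb]

/-- On a permutation invariant proper polyhedral cone with more than `n` extreme vectors, a linear
map having all extreme vectors as eigenvectors is a scalar. -/
lemma exists_scalar_of_isExtremeDiagonal {Q : PointedCone ℝ (EuclideanSpace ℝ (Fin n))}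
    (hQ : IsPermutationInvariant Q) (hK : IsProperCone Q) (hext : (n : ℕ∞) < numExtremeVectors Q)
    {L : EuclideanSpace ℝ (Fin n) →ₗ[ℝ] EuclideanSpace ℝ (Fin n)} (hL : IsExtremeDiagonal Q L) :
    ∃ c : ℝ, ∀ x, L x = c • x := by
  obtain ⟨x, y, hx, hy, hxy, hpar, i, j, hij⟩ : ∃ x y, IsExtremeVector Q x ∧
      IsExtremeVector Q y ∧ IsCoeigen Q x y ∧ (∀ t : ℝ, y ≠ t • x) ∧ ∃ i j, x i ≠ x j := by
    obtain ⟨x, y, hx, hy, hxy, hpar⟩ := exists_isCoeigen_of_finrank_lt hK (by simpa using hext)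
    by_cases hxc : ∃ i j, x i ≠ x j
    · exact ⟨x, y, hx, hy, hxy, hpar, hxc⟩
    push Not at hxc
    have hpar' : ∀ t : ℝ, x ≠ t • y := by
      rintro t h
      have ht : t ≠ 0 := by
        rintro rfl
        exact hx.2.1 (by rw [h, zero_smul])
      exact hpar t⁻¹ (by rw [h, smul_smul, inv_mul_cancel₀ ht, one_smul])
    -- Two constant vectors would be parallel, so the roles can be exchanged.
    refine ⟨y, x, hy, hx, hxy.symm hx hy, hpar', ?_⟩
    by_contra! hyc
    obtain ⟨k, hk⟩ : ∃ k, x k ≠ 0 := by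
      by_contra! h
      exact hx.2.1 (by ext k; exact h k)
    refine hpar (y k / x k) ?_
    ext l
    rw [PiLp.smul_apply, hxc l k, smul_eq_mul, div_mul_cancel₀ _ hk, hyc l k]
  have hij' : i ≠ j := fun h => hij (by rw [h])
  have hτ := hQ.image_permEquiv (Equiv.swap i j)
  have hco : IsCoeigen Q x (permEquiv (Equiv.swap i j) x) := by
    by_contra hsep
    simp only [IsCoeigen] at hsep
    push Not at hsep
    obtain ⟨M, hM, c, hc, hne⟩ := hsep
    obtain ⟨d, hd⟩ := hM _ (hx.map hτ)
    have hyc := hxy M hM c hc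
    have hyd := hxy.map hτ M hM d hd
    -- Chosen so that coordinates `i` and `j` of `y - t • x` agree.
    let t := (y i - y j) / (x i - x j)
    have hfix : y - t • x = permEquiv (Equiv.swap i j) (y - t • x) := by
      have h : (y - t • x) - permEquiv (Equiv.swap i j) (y - t • x) = 0 := by
        rw [sub_permEquiv_swap]
        have : (y - t • x) i - (y - t • x) j = 0 := by
          have := div_mul_cancel₀ (y i - y j) (sub_ne_zero.2 hij)
          simp only [PiLp.sub_apply, PiLp.smul_apply, smul_eq_mul]
          linear_combination -this
        rw [this, zero_smul]
      exact sub_eq_zero.1 h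
    have h1 : M (y - t • x) = c • (y - t • x) := by
      rw [map_sub, map_smul, hyc, hc]
      module
    have h2 : M (y - t • x) = d • (y - t • x) := by
      conv_lhs => rw [hfix]
      conv_rhs => rw [hfix]
      rw [map_sub, map_smul, map_sub, map_smul, hyd, hd]
      module
    have hcd : (c - d) • (y - t • x) = 0 := by rw [sub_smul, ← h1, ← h2, sub_self]
    rcases smul_eq_zero.1 hcd with h | h
    · exact hne (by rw [hd, sub_eq_zero.1 h])
    · exact hpar t (sub_eq_zero.1 h)
  obtain ⟨c, w, hw⟩ := exists_forall_sub_smul_eq hij' fun a b hab =>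
    exists_eigen_single_sub_single hQ hx hij hco hab hL
  by_cases hw0 : w = 0
  · refine ⟨c, fun z => sub_eq_zero.1 ?_⟩
    rw [hw, hw0, smul_zero]
  obtain ⟨d, hd⟩ := hL x hx
  have hyd := hxy L hL d hd
  have hwx := hw x
  have hwy := hw y
  rw [hd, ← sub_smul] at hwx
  rw [hyd, ← sub_smul] at hwy
  have hsx : ∑ k, x k ≠ 0 := fun h => hx.2.1 (eq_zero_of_sum_eq_zero hQ hK hx.1 h)
  have hdc : d - c ≠ 0 := by
    intro h
    rw [h, zero_smul] at hwx
    exact (smul_ne_zero hsx hw0) hwx.symm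
  refine absurd ?_ (hpar ((∑ k, y k) / ∑ k, x k))
  refine smul_right_injective _ hdc ?_
  change (d - c) • y = (d - c) • _
  rw [hwy, smul_comm, hwx, smul_smul, div_mul_cancel₀ _ hsx]

end Permutation

end LyapunovRank

theorem mainTheorem3 (n : ℕ) (Q : PointedCone ℝ (EuclideanSpace ℝ (Fin n)))
    (hperm : LyapunovRank.IsPermutationInvariant Q)
    (hproper : LyapunovRank.IsProperCone Q)
    (hpoly : LyapunovRank.IsPolyhedralCone Q)
    (hext : (n : ℕ∞) < LyapunovRank.numExtremeVectors Q) :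
    LyapunovRank.IsIrreducible Q ∧ LyapunovRank.lyapunovRank Q = 1 := by
  have hscalar := fun L =>
    LyapunovRank.exists_scalar_of_isExtremeDiagonal (L := L) hperm hproper hext
  obtain ⟨x, -, hx, -⟩ :=
    LyapunovRank.exists_isCoeigen_of_finrank_lt hproper (by simpa using hext)
  have : Nontrivial (EuclideanSpace ℝ (Fin n)) := ⟨x, 0, hx.2.1⟩
  refine ⟨⟨fun h => hx.2.1 ?_, LyapunovRank.not_isReducible_of_forall_scalar hproper hscalar⟩, ?_⟩
  · have := hx.1
    rwa [h, Submodule.mem_bot] at this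
  · exact LyapunovRank.lyapunovRank_eq_one_of_forall_scalar fun L hL =>
      hscalar L (LyapunovRank.isExtremeDiagonal_of_mem_lyapunovLike hproper hpoly hL)
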